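/- **Definitions.** A little-oh polynomial is a function $x:[0,\epsilon)\to\mathbb{R}$ (for some $\epsilon>0$) such that $x(t)=x(0)+\sum_{i=1}^{k}\alpha_i t^{a_i}+o(t)$ as $t\to 0^+$, for some $k\in\mathbb{N}$, $\alpha_i\in\mathbb{R}$ and $a_i>0$. Two of them, $x$ and $y$, are equivalent if $x(0)=y(0)$ and $x(t)-y(t)=o(t)$ as $t\to0^+$. The set ${}^\bullet\mathbb{R}$ of Fermat reals is the set of equivalence classes. Every $x\in{}^\bullet\mathbb{R}$ is uniquely of the form ${}^\circ x+\sum_{e\in(0,1]}x_e t^{e}$ with ${}^\circ x=x(0)\in\mathbb{R}$ (the standard part) and $x_e\in\mathbb{R}$, only finitely many of them non-zero. Fermat reals are totally ordered by the dictionary order: first compare standard parts, then the coefficients $x_e$, beginning with the smallest exponent; intervals $[a,b]\subset{}^\bullet\mathbb{R}$ refer to this order. A smooth function $f:\mathbb{R}\to\mathbb{R}$ extends to ${}^\bullet f:{}^\bullet\mathbb{R}\to{}^\bullet\mathbb{R}$, ${}^\bullet f(x)=f\circ x$. A flat point of $f$ is a point $u\in\mathbb{R}$ with $f^{(n)}(u)=0$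 for all $n\ge 1$. **Proposition.** Let $f:\mathbb{R}\to\mathbb{R}$ be smooth, and let $a,b\in{}^\bullet\mathbb{R}$ with $a<b$. Then the restriction ${}^\bullet f|_{[a,b]}$ attains a maximum and a minimum. Moreover, if $f$ has no flat point, then there exist $c,d\in{}^\bullet\mathbb{R}$ with $c\le d$ such that ${}^\bullet f([a,b])=[c,d]$, and $c<d$ unless ${}^\circ a={}^\circ b$ and $f'({}^\circ a)=0$. -/

import Mathlib

open Filter Topology Asymptotics Set
open scoped ContDiff

noncomputable section

namespace Fermat

/-- A little-oh polynomial is a function `x` on some `[0, ε)` with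
`x t = x 0 + ∑ i, α i * t ^ a i + o(t)` as `t → 0+`, where all `a i > 0`.
Only the values near `0` in `[0, ∞)` matter, so `x` is taken to be a total function. -/
def IsLittleOhPoly (x : ℝ → ℝ) : Prop :=
  ∃ (k : ℕ) (α a : Fin k → ℝ), (∀ i, 0 < a i) ∧
    (fun t : ℝ => x t - x 0 - ∑ i, α i * t ^ a i) =o[𝓝[>] 0] (fun t : ℝ => t)

theorem isLittleOhPoly_of_fintype {ι : Type} [Fintype ι] {x : ℝ → ℝ} (α a : ι → ℝ)
    (ha : ∀ i, 0 < a i)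
    (h : (fun t : ℝ => x t - x 0 - ∑ i, α i * t ^ a i) =o[𝓝[>] 0] (fun t : ℝ => t)) :
    IsLittleOhPoly x := by
  refine ⟨Fintype.card ι, α ∘ (Fintype.equivFin ι).symm, a ∘ (Fintype.equivFin ι).symm,
    fun i => ha _, ?_⟩
  refine h.congr_left fun t => ?_
  congr 1
  exact ((Fintype.equivFin ι).symm.sum_comp (fun i => α i * t ^ a i)).symm

theorem IsLittleOhPoly.congr {x y : ℝ → ℝ} (hx : IsLittleOhPoly x) (h0 : x 0 = y 0)
    (h : (fun t : ℝ => x t - y t) =o[𝓝[>] 0] (fun t : ℝ => t)) : IsLittleOhPoly y := by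
  obtain ⟨k, α, a, ha, hk⟩ := hx
  refine ⟨k, α, a, ha, (hk.sub h).congr_left fun t => ?_⟩
  rw [h0]; ring

theorem isLittleOhPoly_const (c : ℝ) : IsLittleOhPoly (fun _ => c) :=
  ⟨0, Fin.elim0, Fin.elim0, fun i => i.elim0, by simp⟩

theorem IsLittleOhPoly.add {x y : ℝ → ℝ} (hx : IsLittleOhPoly x) (hy : IsLittleOhPoly y) :
    IsLittleOhPoly (fun t => x t + y t) := by
  obtain ⟨k, α, a, ha, hk⟩ := hx
  obtain ⟨l, β, b, hb, hl⟩ := hy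
  refine isLittleOhPoly_of_fintype (ι := Fin k ⊕ Fin l) (Sum.elim α β) (Sum.elim a b)
    (by rintro (i | i); exacts [ha i, hb i]) ((hk.add hl).congr_left fun t => ?_)
  simp only [Fintype.sum_sum_type, Sum.elim_inl, Sum.elim_inr]
  ring

theorem isBigO_rpow_one {a : ℝ} (ha : 0 ≤ a) :
    (fun t : ℝ => t ^ a) =O[𝓝[>] 0] (fun _ => (1 : ℝ)) := by
  have h : Tendsto (fun t : ℝ => t ^ a) (𝓝[>] 0) (𝓝 ((0 : ℝ) ^ a)) :=
    ((Real.continuous_rpow_const ha).tendsto 0).mono_left nhdsWithin_le_nhds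
  exact h.isBigO_one ℝ

theorem isBigO_rpow_rpow {a b : ℝ} (hab : a ≤ b) :
    (fun t : ℝ => t ^ b) =O[𝓝[>] 0] (fun t : ℝ => t ^ a) := by
  have h := (isBigO_rpow_one (sub_nonneg.2 hab)).mul
    (isBigO_refl (fun t : ℝ => t ^ a) (𝓝[>] 0))
  refine h.congr' ?_ (by simp)
  filter_upwards [self_mem_nhdsWithin] with t ht
  rw [← Real.rpow_add ht, sub_add_cancel]

/-- The infinitesimal part of a little-oh polynomial is `O(t ^ a)` for some `0 < a ≤ 1`. -/
theorem IsLittleOhPoly.exists_isBigO {x : ℝ → ℝ} (hx : IsLittleOhPoly x) :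
    ∃ a : ℝ, 0 < a ∧ a ≤ 1 ∧
      (fun t : ℝ => x t - x 0) =O[𝓝[>] 0] (fun t : ℝ => t ^ a) := by
  obtain ⟨k, α, a, ha, hk⟩ := hx
  obtain ⟨c, hc0, hc1, hc⟩ : ∃ c : ℝ, 0 < c ∧ c ≤ 1 ∧ ∀ i, c ≤ a i := by
    have hne : (insert 1 (Finset.univ.image a)).Nonempty := Finset.insert_nonempty _ _
    refine ⟨(insert 1 (Finset.univ.image a)).min' hne, ?_, Finset.min'_le _ _ (by simp),
      fun i => Finset.min'_le _ _ (by simp)⟩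
    rw [Finset.lt_min'_iff]
    intro y hy
    simp only [Finset.mem_insert, Finset.mem_image, Finset.mem_univ, true_and] at hy
    rcases hy with rfl | ⟨i, rfl⟩
    exacts [one_pos, ha i]
  refine ⟨c, hc0, hc1, ?_⟩
  have h1 : (fun t : ℝ => t) =O[𝓝[>] 0] (fun t : ℝ => t ^ c) := by
    simpa using isBigO_rpow_rpow hc1
  have h2 : (fun t : ℝ => ∑ i, α i * t ^ a i) =O[𝓝[>] 0] (fun t : ℝ => t ^ c) :=
    IsBigO.fun_sum fun i _ => (isBigO_rpow_rpow (hc i)).const_mul_left _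
  exact ((hk.isBigO.trans h1).add h2).congr_left fun t => by ring

theorem IsLittleOhPoly.tendsto {x : ℝ → ℝ} (hx : IsLittleOhPoly x) :
    Tendsto x (𝓝[>] 0) (𝓝 (x 0)) := by
  obtain ⟨a, ha0, -, h⟩ := hx.exists_isBigO
  have h2 : Tendsto (fun t : ℝ => t ^ a) (𝓝[>] 0) (𝓝 0) := by
    have := ((Real.continuous_rpow_const ha0.le).tendsto 0).mono_left
      (nhdsWithin_le_nhds (s := Ioi (0 : ℝ)))
    rwa [Real.zero_rpow ha0.ne'] at this
  have h3 := (h.trans_tendsto h2).add_const (x 0)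
  simpa using h3

theorem IsLittleOhPoly.mul {x y : ℝ → ℝ} (hx : IsLittleOhPoly x) (hy : IsLittleOhPoly y) :
    IsLittleOhPoly (fun t => x t * y t) := by
  have hxb := hx.tendsto.isBigO_one ℝ
  obtain ⟨k, α, a, ha, hk⟩ := hx
  obtain ⟨l, β, b, hb, hl⟩ := hy
  have hq : (fun t : ℝ => y 0 + ∑ j, β j * t ^ b j) =O[𝓝[>] 0] (fun _ => (1 : ℝ)) :=
    (isBigO_const_const _ one_ne_zero _).add
      (IsBigO.fun_sum fun j _ => (isBigO_rpow_one (hb j).le).const_mul_left _)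
  refine isLittleOhPoly_of_fintype (ι := (Fin k ⊕ Fin l) ⊕ Fin k × Fin l)
    (Sum.elim (Sum.elim (fun i => α i * y 0) (fun j => x 0 * β j)) (fun p => α p.1 * β p.2))
    (Sum.elim (Sum.elim a b) (fun p => a p.1 + b p.2))
    (by rintro ((i | i) | p); exacts [ha i, hb i, add_pos (ha _) (hb _)]) ?_
  have h := (hxb.mul_isLittleO hl).add (hq.mul_isLittleO hk)
  simp only [one_mul] at h
  refine h.congr' ?_ EventuallyEq.rfl
  filter_upwards [self_mem_nhdsWithin] with t ht
  have e : ∑ p : Fin k × Fin l, α p.1 * β p.2 * t ^ (a p.1 + b p.2) =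
      (∑ i, α i * t ^ a i) * ∑ j, β j * t ^ b j := by
    rw [Finset.sum_mul_sum, Fintype.sum_prod_type]
    refine Finset.sum_congr rfl fun i _ => Finset.sum_congr rfl fun j _ => ?_
    rw [Real.rpow_add ht]; ring
  have e1 : ∑ i, α i * y 0 * t ^ a i = y 0 * ∑ i, α i * t ^ a i := by
    rw [Finset.mul_sum]; exact Finset.sum_congr rfl fun i _ => by ring
  have e2 : ∑ j, x 0 * β j * t ^ b j = x 0 * ∑ j, β j * t ^ b j := by
    rw [Finset.mul_sum]; exact Finset.sum_congr rfl fun i _ => by ring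
  simp only [Fintype.sum_sum_type, Sum.elim_inl, Sum.elim_inr, e, e1, e2]
  ring

theorem IsLittleOhPoly.pow {x : ℝ → ℝ} (hx : IsLittleOhPoly x) (n : ℕ) :
    IsLittleOhPoly (fun t => x t ^ n) := by
  induction n with
  | zero => simpa using isLittleOhPoly_const 1
  | succ n ih => simpa only [pow_succ] using ih.mul hx

theorem isLittleOhPoly_sum {ι : Type} (s : Finset ι) (x : ι → ℝ → ℝ)
    (hx : ∀ i ∈ s, IsLittleOhPoly (x i)) : IsLittleOhPoly (fun t => ∑ i ∈ s, x i t) := by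
  classical
  induction s using Finset.induction_on with
  | empty => simpa using isLittleOhPoly_const 0
  | insert i s hi ih =>
    simp only [Finset.sum_insert hi]
    exact (hx i (by simp)).add (ih fun j hj => hx j (by simp [hj]))

/-- Little-oh polynomials are preserved by composition with smooth functions. -/
theorem IsLittleOhPoly.comp {f : ℝ → ℝ} (hf : ContDiff ℝ ∞ f) {x : ℝ → ℝ}
    (hx : IsLittleOhPoly x) : IsLittleOhPoly (fun t => f (x t)) := by
  obtain ⟨a, ha0, ha1, hO⟩ := hx.exists_isBigO
  obtain ⟨n, hn⟩ := exists_nat_ge (1 / a)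
  have hn1 : 1 ≤ a * n := by rwa [div_le_iff₀ ha0, mul_comm] at hn
  have hT := (taylor_isLittleO_univ (x₀ := x 0) (n := n)
    (hf.of_le (by exact_mod_cast le_top))).comp_tendsto hx.tendsto
  have hP : (fun t : ℝ => (x t - x 0) ^ n) =O[𝓝[>] 0] (fun t : ℝ => t) := by
    have h2 := isBigO_rpow_rpow hn1
    refine ((hO.pow n).congr' EventuallyEq.rfl ?_).trans (h2.congr_right fun t => by simp)
    filter_upwards [self_mem_nhdsWithin] with t ht
    rw [← Real.rpow_natCast, ← Real.rpow_mul (le_of_lt ht)]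
  have hlo := hT.trans_isBigO hP
  have hp : IsLittleOhPoly (fun t => taylorWithinEval f n univ (x 0) (x t)) := by
    simp only [taylor_within_apply]
    refine isLittleOhPoly_sum _ _ fun i _ => ?_
    have hs : IsLittleOhPoly (fun t => x t - x 0) := by
      simpa only [sub_eq_add_neg] using hx.add (isLittleOhPoly_const (-(x 0)))
    exact ((isLittleOhPoly_const _).mul (hs.pow i)).mul (isLittleOhPoly_const _)
  refine hp.congr (by simp) ?_
  exact hlo.neg_left.congr_left fun t => by simp

/-- The type of little-oh polynomials. -/
def LittleOhPoly : Type := {x : ℝ → ℝ // IsLittleOhPoly x}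

/-- Two little-oh polynomials are equivalent if they agree at `0` and differ by `o(t)`. -/
instance littleOhSetoid : Setoid LittleOhPoly where
  r x y := x.1 0 = y.1 0 ∧ (fun t : ℝ => x.1 t - y.1 t) =o[𝓝[>] 0] (fun t : ℝ => t)
  iseqv :=
    { refl := fun x => ⟨rfl, by simp⟩
      symm := fun {x y} h => ⟨h.1.symm, h.2.neg_left.congr_left fun t => by ring⟩
      trans := fun {x y z} h h' =>
        ⟨h.1.trans h'.1, (h.2.add h'.2).congr_left fun t => by ring⟩ }

end Fermat

/-- The Fermat reals: little-oh polynomials up to equivalence. -/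
def FermatReal : Type := Quotient Fermat.littleOhSetoid

namespace FermatReal

open Fermat

/-- The standard part `°x`. -/
def st : FermatReal → ℝ :=
  Quotient.lift (fun x : LittleOhPoly => x.1 0) fun _ _ h => h.1

/-- The Fermat extension of a smooth function `f : ℝ → ℝ`, given by `x ↦ f ∘ x`. -/
def ext (f : ℝ → ℝ) (hf : ContDiff ℝ ∞ f) : FermatReal → FermatReal :=
  Quotient.map (fun x : LittleOhPoly => (⟨fun t => f (x.1 t), x.2.comp hf⟩ : LittleOhPoly))
    (by
      rintro ⟨x, hx⟩ ⟨y, hy⟩ ⟨h0, h⟩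
      change x 0 = y 0 at h0
      refine ⟨congrArg f h0, ?_⟩
      have hs : HasStrictDerivAt f (deriv f (x 0)) (x 0) :=
        hf.contDiffAt.hasStrictDerivAt (by simp)
      have hxy : Tendsto (fun t => (x t, y t)) (𝓝[>] 0) (𝓝 (x 0, x 0)) :=
        hx.tendsto.prodMk_nhds (h0 ▸ hy.tendsto)
      exact (hs.hasStrictFDerivAt.isBigO_sub.comp_tendsto hxy).trans_isLittleO h)

/-- The function `r + ∑ e, c e * t ^ e`, with exponents `e ∈ (0, 1]`. -/
def decompFun (r : ℝ) (c : Ioc (0 : ℝ) 1 →₀ ℝ) (t : ℝ) : ℝ :=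
  r + c.sum fun e v => v * t ^ (e : ℝ)

theorem decompFun_zero (r : ℝ) (c : Ioc (0 : ℝ) 1 →₀ ℝ) : decompFun r c 0 = r := by
  have h : c.sum (fun e v => v * (0 : ℝ) ^ (e : ℝ)) = 0 :=
    Finset.sum_eq_zero fun e _ => by
      change c e * (0 : ℝ) ^ (e : ℝ) = 0
      rw [Real.zero_rpow e.2.1.ne', mul_zero]
  rw [decompFun, h, add_zero]

theorem isLittleOhPoly_decompFun (r : ℝ) (c : Ioc (0 : ℝ) 1 →₀ ℝ) :
    IsLittleOhPoly (decompFun r c) := by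
  refine isLittleOhPoly_of_fintype (ι := c.support) (fun e => c e) (fun e => (e.1 : ℝ))
    (fun e => e.1.2.1) ?_
  refine (isLittleO_zero _ _).congr_left fun t => ?_
  rw [decompFun_zero, decompFun, Finsupp.sum, ← Finset.sum_coe_sort]
  ring

/-- The Fermat real with standard part `r` and coefficients `c`. -/
def ofDecomp (p : ℝ × (Ioc (0 : ℝ) 1 →₀ ℝ)) : FermatReal :=
  Quotient.mk _ ⟨decompFun p.1 p.2, isLittleOhPoly_decompFun p.1 p.2⟩

theorem ofDecomp_injective : Function.Injective ofDecomp := by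
  rintro ⟨r, c⟩ ⟨s, d⟩ h
  obtain ⟨h0, h⟩ := Quotient.exact h
  change decompFun r c 0 = decompFun s d 0 at h0
  rw [decompFun_zero, decompFun_zero] at h0
  subst h0
  congr 1
  rw [← sub_eq_zero]
  by_contra hne
  set u := c - d with hu
  have hsum : (fun t : ℝ => u.sum fun e v => v * t ^ (e : ℝ)) =o[𝓝[>] 0] (fun t : ℝ => t) := by
    refine h.congr_left fun t => ?_
    change decompFun r c t - decompFun r d t = _
    rw [hu, Finsupp.sum_sub_index fun _ _ _ => by ring, decompFun, decompFun]
    ring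
  have hs : u.support.Nonempty := Finsupp.support_nonempty_iff.2 hne
  set m := u.support.min' hs with hm
  have hmem : m ∈ u.support := Finset.min'_mem _ _
  have h1 : (fun t : ℝ => t) =O[𝓝[>] 0] (fun t : ℝ => t ^ (m : ℝ)) := by
    simpa using isBigO_rpow_rpow m.2.2
  have h2 : (fun t : ℝ => u m * t ^ (m : ℝ)) =o[𝓝[>] 0] (fun t : ℝ => t ^ (m : ℝ)) := by
    have h3 : (fun t : ℝ => ∑ e ∈ u.support.erase m, u e * t ^ (e : ℝ)) =o[𝓝[>] 0]
        (fun t : ℝ => t ^ (m : ℝ)) := by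
      refine IsLittleO.fun_sum fun e he => IsLittleO.const_mul_left ?_ _
      have hlt : (m : ℝ) < e := by
        have h5 := Finset.mem_erase.1 he
        exact_mod_cast lt_of_le_of_ne (Finset.min'_le _ _ h5.2) h5.1.symm
      have h4 : Tendsto (fun t : ℝ => t ^ ((e : ℝ) - m)) (𝓝[>] 0) (𝓝 0) := by
        have := ((Real.continuous_rpow_const (sub_pos.2 hlt).le).tendsto 0).mono_left
          (nhdsWithin_le_nhds (s := Ioi (0 : ℝ)))
        rwa [Real.zero_rpow (sub_pos.2 hlt).ne'] at this
      have h6 := ((isLittleO_one_iff ℝ).2 h4).mul_isBigO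
        (isBigO_refl (fun t : ℝ => t ^ (m : ℝ)) (𝓝[>] 0))
      refine h6.congr' ?_ (by simp)
      filter_upwards [self_mem_nhdsWithin] with t ht
      rw [← Real.rpow_add ht, sub_add_cancel]
    refine ((hsum.trans_isBigO h1).sub h3).congr_left fun t => ?_
    rw [Finsupp.sum, ← Finset.add_sum_erase _ _ hmem]
    ring
  have h7 := (isLittleO_const_mul_left_iff (Finsupp.mem_support_iff.1 hmem)).1 h2
  refine isLittleO_irrefl ?_ h7
  refine Eventually.frequently ?_
  filter_upwards [self_mem_nhdsWithin] with t ht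
  exact (Real.rpow_pos_of_pos ht _).ne'

theorem ofDecomp_surjective : Function.Surjective ofDecomp := by
  rintro ⟨x, hx⟩
  obtain ⟨k, α, a, ha, hk⟩ := hx
  let c : Ioc (0 : ℝ) 1 →₀ ℝ :=
    ∑ i, if h : a i ≤ 1 then Finsupp.single ⟨a i, ha i, h⟩ (α i) else 0
  refine ⟨(x 0, c), Quotient.sound ⟨decompFun_zero _ _, ?_⟩⟩
  change (fun t : ℝ => decompFun (x 0) c t - x t) =o[𝓝[>] 0] (fun t : ℝ => t)
  have hc : ∀ t : ℝ, (c.sum fun e v => v * t ^ (e : ℝ)) =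
      ∑ i, if a i ≤ 1 then α i * t ^ a i else 0 := by
    intro t
    rw [← Finsupp.sum_finsetSum_index (fun _ => by simp) (fun _ _ _ => by ring)]
    refine Finset.sum_congr rfl fun i _ => ?_
    split_ifs <;> simp
  have hr : (fun t : ℝ => ∑ i, if a i ≤ 1 then 0 else α i * t ^ a i) =o[𝓝[>] 0]
      (fun t : ℝ => t) := by
    refine IsLittleO.fun_sum fun i _ => ?_
    split_ifs with h
    · exact isLittleO_zero _ _
    · have h1 : 0 < a i - 1 := by linarith
      have h4 : Tendsto (fun t : ℝ => t ^ (a i - 1)) (𝓝[>] 0) (𝓝 0) := by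
        have := ((Real.continuous_rpow_const h1.le).tendsto 0).mono_left
          (nhdsWithin_le_nhds (s := Ioi (0 : ℝ)))
        rwa [Real.zero_rpow h1.ne'] at this
      have h6 := (((isLittleO_one_iff ℝ).2 h4).mul_isBigO
        (isBigO_refl (fun t : ℝ => t) (𝓝[>] 0))).const_mul_left (α i)
      refine h6.congr' ?_ (by simp)
      filter_upwards [self_mem_nhdsWithin] with t ht
      rw [Real.rpow_sub_one (ne_of_gt ht), div_mul_cancel₀ _ (ne_of_gt ht)]
  refine (hk.add hr).neg_left.congr_left fun t => ?_
  have e : ∑ i, α i * t ^ a i = (∑ i, if a i ≤ 1 then α i * t ^ a i else 0) +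
      ∑ i, if a i ≤ 1 then 0 else α i * t ^ a i := by
    rw [← Finset.sum_add_distrib]
    refine Finset.sum_congr rfl fun i _ => ?_
    split_ifs <;> simp
  rw [decompFun, hc, e]
  ring

/-- The decomposition of a Fermat real: every Fermat real is `°x + ∑ e, c e * t ^ e` for a
unique finitely supported family `c` of coefficients indexed by the exponents `e ∈ (0, 1]`. -/
def decomp : FermatReal ≃ ℝ × (Ioc (0 : ℝ) 1 →₀ ℝ) :=
  (Equiv.ofBijective ofDecomp ⟨ofDecomp_injective, ofDecomp_surjective⟩).symm

theorem decomp_fst (x : FermatReal) : (decomp x).1 = st x := by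
  obtain ⟨p, rfl⟩ := ofDecomp_surjective x
  have h : decomp (ofDecomp p) = p :=
    (Equiv.ofBijective ofDecomp ⟨ofDecomp_injective, ofDecomp_surjective⟩).symm_apply_apply p
  rw [h]
  exact (decompFun_zero p.1 p.2).symm

/-- The standard part followed by the coefficients, in the dictionary order: the standard parts
are compared first, then the coefficients, beginning with the smallest exponent. -/
def lexCoeffs (x : FermatReal) : ℝ ×ₗ Lex (Ioc (0 : ℝ) 1 →₀ ℝ) :=
  toLex ((decomp x).1, toLex (decomp x).2)

theorem lexCoeffs_injective : Function.Injective lexCoeffs := by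
  intro x y h
  have h' := Prod.ext_iff.1 (toLex.injective h)
  exact decomp.injective (Prod.ext h'.1 (toLex.injective h'.2))

/-- The total order on the Fermat reals. -/
instance : LinearOrder FermatReal := LinearOrder.lift' lexCoeffs lexCoeffs_injective

end FermatReal

/-- A flat point of `f`: all derivatives of positive order vanish there. -/
def IsFlatPoint (f : ℝ → ℝ) (u : ℝ) : Prop := ∀ n : ℕ, 0 < n → iteratedDeriv n f u = 0

end

/-! Inequalities pass between `f` and its extension through representatives. For `x < y` the
canonical representatives are separated by a positive multiple of `t`, because all exponents are at
most 1; hence an eventual inequality between any representatives descends to classes (`mk_le_mk`).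

Extrema: standard parts are compared first, so only points whose standard part maximises `f` on
`[°a, °b]` compete. A real maximiser strictly inside dominates every point with interior standard
part. Infinitesimally near a real `u`, the extension is monotone or antitone on each side: at a flat
point it is constant, and otherwise `f` itself is monotone or antitone on a real interval on each
side. This settles the two ends, and the best of three candidates is the maximum (`exists_isMaxOn`).
Minima come from `-f`.

Image: it is `[min, max]` by an intermediate value theorem (`hasIVT`). Its core is
`exists_ext_eq_right`, which solves `f x = y` infinitesimally near a non-flat `u`: with `f (u + h) ≈
f u + h ^ n * Q h` and `y = f u + t ^ m * W t`, an `n`-th root turns the equation into one solved by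
a smooth local inverse. Reflections in the domain and codomain reduce the other cases to this one,
and intervals are glued from infinitesimal and real pieces. Non-degeneracy holds since constancy on
a real interval produces flat points, while `f' ≠ 0` makes the extension injective on the
infinitesimal neighbourhood. -/

namespace Fermat

/-! ### Little-oh polynomials: local composition and leading monomials. -/

/-- Little-oh polynomials are preserved by functions that are smooth at the value at `0`. -/
theorem IsLittleOhPoly.comp_contDiffAt {F x : ℝ → ℝ} (hx : IsLittleOhPoly x)
    (hF : ContDiffAt ℝ ∞ F (x 0)) : IsLittleOhPoly (fun t => F (x t)) := by
  obtain ⟨a, ha0, ha1, hO⟩ := hx.exists_isBigO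
  obtain ⟨n, hn⟩ := exists_nat_ge (1 / a)
  have hn1 : 1 ≤ a * n := by rwa [div_le_iff₀ ha0, mul_comm] at hn
  -- Smoothness at a point gives, for each finite order, a neighbourhood that may depend on it; so
  -- `n` is fixed beforehand, large enough that the `n`-th power of the increment is `O(t)`. The
  -- ball supplies the convexity needed by Taylor's theorem.
  obtain ⟨s, hs, hFs⟩ := hF.contDiffOn (m := n) (by exact_mod_cast le_top) (by simp)
  obtain ⟨r, hr, hrs⟩ := Metric.mem_nhds_iff.1 (by simpa using hs : s ∈ 𝓝 (x 0))
  have hT0 := taylor_isLittleO (convex_ball (x 0) r) (Metric.mem_ball_self hr) (hFs.mono hrs)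
  rw [Metric.isOpen_ball.nhdsWithin_eq (Metric.mem_ball_self hr)] at hT0
  have hT := hT0.comp_tendsto hx.tendsto
  have hP : (fun t : ℝ => (x t - x 0) ^ n) =O[𝓝[>] 0] (fun t : ℝ => t) := by
    have h2 := isBigO_rpow_rpow hn1
    refine ((hO.pow n).congr' EventuallyEq.rfl ?_).trans (h2.congr_right fun t => by simp)
    filter_upwards [self_mem_nhdsWithin] with t ht
    rw [← Real.rpow_natCast, ← Real.rpow_mul (le_of_lt ht)]
  have hlo := hT.trans_isBigO hP
  have hp : IsLittleOhPoly (fun t => taylorWithinEval F n (Metric.ball (x 0) r) (x 0) (x t)) := by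
    simp only [taylor_within_apply]
    refine isLittleOhPoly_sum _ _ fun i _ => ?_
    have hs : IsLittleOhPoly (fun t => x t - x 0) := by
      simpa only [sub_eq_add_neg] using hx.add (isLittleOhPoly_const (-(x 0)))
    exact ((isLittleOhPoly_const _).mul (hs.pow i)).mul (isLittleOhPoly_const _)
  refine hp.congr (by simp) ?_
  exact hlo.neg_left.congr_left fun t => by simp

theorem isLittleOhPoly_const_mul_rpow (c : ℝ) {a : ℝ} (ha : 0 < a) :
    IsLittleOhPoly (fun t => c * t ^ a) := by
  refine isLittleOhPoly_of_fintype (ι := Unit) (fun _ => c) (fun _ => a) (fun _ => ha) ?_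
  simp [Real.zero_rpow ha.ne']

/-- A generalized polynomial is its leading monomial times a little-oh polynomial whose value
at `0` is the leading coefficient. -/
theorem exists_factor_leading (u : Ioc (0 : ℝ) 1 →₀ ℝ) (m : Ioc (0 : ℝ) 1)
    (hm : ∀ i < m, u i = 0) :
    ∃ W : ℝ → ℝ, IsLittleOhPoly W ∧ W 0 = u m ∧
      ∀ t : ℝ, 0 < t → (u.sum fun e v => v * t ^ (e : ℝ)) = t ^ (m : ℝ) * W t := by
  classical
  have hlt : ∀ e ∈ u.support.erase m, (m : ℝ) < e := by
    intro e he
    obtain ⟨h1, h2⟩ := Finset.mem_erase.1 he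
    by_contra h
    exact Finsupp.mem_support_iff.1 h2 (hm e (lt_of_le_of_ne (not_lt.1 fun h' => h h') h1))
  refine ⟨fun t => u m + ∑ e ∈ u.support.erase m, u e * t ^ ((e : ℝ) - m),
    (isLittleOhPoly_const _).add (isLittleOhPoly_sum _ _ fun e he =>
      isLittleOhPoly_const_mul_rpow _ (sub_pos.2 (hlt e he))), ?_, fun t ht => ?_⟩
  · beta_reduce
    rw [Finset.sum_eq_zero, add_zero]
    intro e he
    rw [Real.zero_rpow (sub_pos.2 (hlt e he)).ne', mul_zero]
  -- `u m` may be zero, so `m` has to be added to the support.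
  · have h1 : (u.sum fun e v => v * t ^ (e : ℝ)) =
        ∑ e ∈ insert m (u.support.erase m), u e * t ^ (e : ℝ) := by
      refine Finset.sum_subset (fun e he => ?_) (fun e _ he => ?_)
      · by_cases h : e = m <;> simp_all
      · simp [Finsupp.notMem_support_iff.1 he]
    rw [h1, Finset.sum_insert (Finset.notMem_erase _ _), mul_add, Finset.mul_sum]
    congr 1
    · ring
    · refine Finset.sum_congr rfl fun e _ => ?_
      have h2 : t ^ (m : ℝ) * t ^ ((e : ℝ) - m) = t ^ (e : ℝ) := by
        rw [← Real.rpow_add ht, add_sub_cancel]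
      rw [← h2]; ring

end Fermat

/-! ### Canonical representatives, order and negation. -/

namespace FermatReal

open Fermat

noncomputable section

/-- The class of a little-oh polynomial. -/
def mk (x : ℝ → ℝ) (hx : IsLittleOhPoly x) : FermatReal :=
  Quotient.mk littleOhSetoid ⟨x, hx⟩

theorem mk_eq_mk {x y : ℝ → ℝ} {hx : IsLittleOhPoly x} {hy : IsLittleOhPoly y} :
    mk x hx = mk y hy ↔
      x 0 = y 0 ∧ (fun t : ℝ => x t - y t) =o[𝓝[>] 0] (fun t : ℝ => t) :=
  Quotient.eq (r := littleOhSetoid)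

/-- The canonical representative of a Fermat real. -/
def rep (a : FermatReal) : ℝ → ℝ := decompFun (decomp a).1 (decomp a).2

theorem isLittleOhPoly_rep (a : FermatReal) : IsLittleOhPoly (rep a) :=
  isLittleOhPoly_decompFun _ _

theorem mk_rep (a : FermatReal) : mk (rep a) (isLittleOhPoly_rep a) = a :=
  decomp.symm_apply_apply a

theorem rep_zero (a : FermatReal) : rep a 0 = st a := by
  rw [rep, decompFun_zero, decomp_fst]

theorem st_mk {x : ℝ → ℝ} {hx : IsLittleOhPoly x} : st (mk x hx) = x 0 := rfl

theorem tendsto_rep (a : FermatReal) : Tendsto (rep a) (𝓝[>] 0) (𝓝 (st a)) :=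
  rep_zero a ▸ (isLittleOhPoly_rep a).tendsto

theorem rep_mk_sub (x : ℝ → ℝ) (hx : IsLittleOhPoly x) :
    (fun t => rep (mk x hx) t - x t) =o[𝓝[>] 0] (fun t : ℝ => t) :=
  (mk_eq_mk.1 (mk_rep (mk x hx))).2

theorem ext_mk {f : ℝ → ℝ} (hf : ContDiff ℝ ∞ f) {x : ℝ → ℝ} (hx : IsLittleOhPoly x) :
    ext f hf (mk x hx) = mk (fun t => f (x t)) (hx.comp hf) := rfl

theorem ext_eq_mk_rep {f : ℝ → ℝ} (hf : ContDiff ℝ ∞ f) (a : FermatReal) :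
    ext f hf a = mk (fun t => f (rep a t)) ((isLittleOhPoly_rep a).comp hf) := by
  conv_lhs => rw [← mk_rep a]
  rfl

theorem st_ext {f : ℝ → ℝ} (hf : ContDiff ℝ ∞ f) (a : FermatReal) :
    st (ext f hf a) = f (st a) := by
  rw [ext_eq_mk_rep, st_mk, rep_zero]

theorem lt_iff_decomp {a b : FermatReal} : a < b ↔ st a < st b ∨ st a = st b ∧
    ∃ i, (∀ j < i, (decomp a).2 j = (decomp b).2 j) ∧ (decomp a).2 i < (decomp b).2 i := by
  rw [← decomp_fst, ← decomp_fst]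
  change lexCoeffs a < lexCoeffs b ↔ _
  rw [Prod.Lex.lt_iff]
  rfl

/-- Canonical representatives of distinct Fermat reals are separated by a multiple of `t`. -/
theorem exists_rep_add_le {a b : FermatReal} (h : a < b) :
    ∃ κ : ℝ, 0 < κ ∧ ∀ᶠ t in 𝓝[>] 0, rep a t + κ * t ≤ rep b t := by
  have ht1 : ∀ᶠ t : ℝ in 𝓝[>] 0, t < 1 := nhdsWithin_le_nhds (Iio_mem_nhds one_pos)
  rcases lt_iff_decomp.1 h with h | ⟨h0, i, hi, hlt⟩
  · refine ⟨(st b - st a) / 2, by linarith, ?_⟩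
    have h1 := ((tendsto_rep b).sub (tendsto_rep a)).eventually_const_le
      (show (st b - st a) / 2 < st b - st a by linarith)
    filter_upwards [h1, ht1, self_mem_nhdsWithin] with t h1 h2 (h3 : 0 < t)
    nlinarith
  · obtain ⟨W, hW, hW0, hWt⟩ := exists_factor_leading ((decomp b).2 - (decomp a).2) i
      (fun j hj => by simp [hi j hj])
    have hpos : 0 < W 0 := by rw [hW0]; simpa using hlt
    refine ⟨W 0 / 2, by linarith, ?_⟩
    have h1 := hW.tendsto.eventually_const_le (show W 0 / 2 < W 0 by linarith)
    filter_upwards [h1, ht1, self_mem_nhdsWithin] with t h1 h2 (h3 : 0 < t)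
    have h4 := hWt t h3
    rw [Finsupp.sum_sub_index fun _ _ _ => by ring] at h4
    have h5 : rep b t - rep a t = t ^ (i : ℝ) * W t := by
      rw [← h4, rep, rep, decompFun, decompFun, decomp_fst, decomp_fst, h0]; ring
    -- Exponents are at most 1, so the leading term of the difference dominates a multiple of `t`.
    have h6 : t ≤ t ^ (i : ℝ) := by
      simpa using Real.rpow_le_rpow_of_exponent_ge h3 h2.le i.2.2
    nlinarith

theorem eventually_rep_lt {a b : FermatReal} (h : a < b) :
    ∀ᶠ t in 𝓝[>] 0, rep a t < rep b t := by
  obtain ⟨κ, hκ, h⟩ := exists_rep_add_le h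
  filter_upwards [h, self_mem_nhdsWithin] with t h1 (h2 : 0 < t)
  nlinarith

theorem eventually_rep_le {a b : FermatReal} (h : a ≤ b) :
    ∀ᶠ t in 𝓝[>] 0, rep a t ≤ rep b t := by
  rcases h.eq_or_lt with rfl | h
  · exact Eventually.of_forall fun _ => le_rfl
  · exact (eventually_rep_lt h).mono fun _ => le_of_lt

/-- If the classes were in the opposite strict order, their canonical representatives would differ
by at least `κ * t`; replacing them by `x` and `y` costs at most `κ / 4 * t` each, which leaves `y t
< x t`. -/
theorem mk_le_mk {x y : ℝ → ℝ} {hx : IsLittleOhPoly x} {hy : IsLittleOhPoly y}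
    (h : ∀ᶠ t in 𝓝[>] 0, x t ≤ y t) : mk x hx ≤ mk y hy := by
  by_contra hlt
  obtain ⟨κ, hκ, hlt⟩ := exists_rep_add_le (not_le.1 hlt)
  have h1 := (rep_mk_sub x hx).def (show 0 < κ / 4 by linarith)
  have h2 := (rep_mk_sub y hy).def (show 0 < κ / 4 by linarith)
  have h3 : ∀ᶠ t : ℝ in 𝓝[>] 0, False := by
    filter_upwards [h, h1, h2, hlt, self_mem_nhdsWithin] with t h h1 h2 h3 (h4 : 0 < t)
    rw [Real.norm_eq_abs, Real.norm_of_nonneg h4.le, abs_le] at h1 h2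
    nlinarith
  exact h3.exists.choose_spec

theorem ext_le_ext_of_eventually {f g : ℝ → ℝ} {hf : ContDiff ℝ ∞ f} {hg : ContDiff ℝ ∞ g}
    {a b : FermatReal} (h : ∀ᶠ t in 𝓝[>] 0, f (rep a t) ≤ g (rep b t)) :
    ext f hf a ≤ ext g hg b := by
  rw [ext_eq_mk_rep, ext_eq_mk_rep]
  exact mk_le_mk h

theorem st_le_st {a b : FermatReal} (h : a ≤ b) : st a ≤ st b := by
  rcases h.eq_or_lt with rfl | h
  · rfl
  · rcases lt_iff_decomp.1 h with h | h
    exacts [h.le, h.1.le]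

theorem lt_of_st_lt {a b : FermatReal} (h : st a < st b) : a < b :=
  lt_iff_decomp.2 (Or.inl h)

/-- The Fermat real of a real number. -/
def ofReal (r : ℝ) : FermatReal := mk (fun _ => r) (isLittleOhPoly_const r)

theorem st_ofReal (r : ℝ) : st (ofReal r) = r := rfl

theorem decomp_ofReal (r : ℝ) : decomp (ofReal r) = (r, 0) := by
  have h : ofReal r = ofDecomp (r, 0) := by
    refine mk_eq_mk.2 ⟨(decompFun_zero r 0).symm, ?_⟩
    simp [decompFun]
  rw [h]
  exact decomp.apply_symm_apply (r, 0)

theorem rep_ofReal (r t : ℝ) : rep (ofReal r) t = r := by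
  simp [rep, decomp_ofReal, decompFun]

theorem ext_ofReal {f : ℝ → ℝ} (hf : ContDiff ℝ ∞ f) (r : ℝ) :
    ext f hf (ofReal r) = ofReal (f r) := rfl

/-- Negation of Fermat reals. -/
def neg (a : FermatReal) : FermatReal := ext (fun x => -x) contDiff_neg a

theorem neg_neg (a : FermatReal) : neg (neg a) = a := by
  conv_rhs => rw [← mk_rep a]
  conv_lhs => rw [← mk_rep a]
  rw [neg, neg, ext_mk, ext_mk]
  simp

theorem st_neg (a : FermatReal) : st (neg a) = -st a := st_ext _ a

theorem neg_ofReal (r : ℝ) : neg (ofReal r) = ofReal (-r) := rfl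

theorem neg_le_neg {a b : FermatReal} (h : a ≤ b) : neg b ≤ neg a :=
  ext_le_ext_of_eventually ((eventually_rep_le h).mono fun _ => _root_.neg_le_neg)

theorem neg_le_neg_iff {a b : FermatReal} : neg b ≤ neg a ↔ a ≤ b :=
  ⟨fun h => by simpa only [neg_neg] using neg_le_neg h, neg_le_neg⟩

theorem neg_le_iff {a b : FermatReal} : neg a ≤ b ↔ neg b ≤ a := by
  rw [← neg_le_neg_iff, neg_neg]

theorem le_neg_iff {a b : FermatReal} : a ≤ neg b ↔ b ≤ neg a := by
  rw [← neg_le_neg_iff, neg_neg]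

theorem ext_neg_comp {f : ℝ → ℝ} (hf : ContDiff ℝ ∞ f) (a : FermatReal) :
    ext (fun x => -f x) hf.neg a = neg (ext f hf a) := by
  rw [← mk_rep a]; rfl

theorem ext_comp_neg {f : ℝ → ℝ} (hf : ContDiff ℝ ∞ f) (a : FermatReal) :
    ext (fun x => f (-x)) (hf.comp contDiff_neg) a = ext f hf (neg a) := by
  rw [← mk_rep a]; rfl

end

end FermatReal

/-! ### One-sided monotonicity near a non-flat point. -/

namespace Fermat

/-- A smooth function some derivative of which does not vanish at `u` has constant sign on some
interval to the right of `u`. -/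
theorem exists_sign_right {g : ℝ → ℝ} (hg : ContDiff ℝ ∞ g) {u : ℝ} {n : ℕ}
    (hn : iteratedDeriv n g u ≠ 0) :
    ∃ δ : ℝ, 0 < δ ∧ ((∀ x ∈ Icc u (u + δ), 0 ≤ g x) ∨ ∀ x ∈ Icc u (u + δ), g x ≤ 0) := by
  have key : ∀ P : ℝ → Prop, (∀ᶠ x in 𝓝 u, P x) → ∃ δ : ℝ, 0 < δ ∧ ∀ x ∈ Icc u (u + δ), P x := by
    intro P hP
    obtain ⟨δ, hδ, h⟩ := Metric.eventually_nhds_iff.1 hP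
    refine ⟨δ / 2, half_pos hδ, fun x hx => h ?_⟩
    rw [Real.dist_eq, abs_lt]
    constructor <;> linarith [hx.1, hx.2]
  have key2 : ∀ g : ℝ → ℝ, ContDiff ℝ ∞ g → g u ≠ 0 → ∃ δ : ℝ, 0 < δ ∧
      ((∀ x ∈ Icc u (u + δ), 0 ≤ g x) ∨ ∀ x ∈ Icc u (u + δ), g x ≤ 0) := by
    intro g hg h0
    rcases lt_or_gt_of_ne h0 with h | h
    · obtain ⟨δ, hδ, h⟩ := key _ (hg.continuous.continuousAt.eventually_le_const h)
      exact ⟨δ, hδ, Or.inr h⟩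
    · obtain ⟨δ, hδ, h⟩ := key _ (hg.continuous.continuousAt.eventually_const_le h)
      exact ⟨δ, hδ, Or.inl h⟩
  induction n generalizing g with
  | zero => exact key2 g hg (by simpa using hn)
  | succ n ih =>
    -- If `g u = 0`, the sign of `g'` to the right of `u` makes `g` move away from zero in one
    -- direction only.
    by_cases h0 : g u = 0
    · rw [iteratedDeriv_succ'] at hn
      have hg' : ContDiff ℝ ∞ (deriv g) := (contDiff_infty_iff_deriv.1 hg).2
      obtain ⟨δ, hδ, h⟩ := ih hg' hn
      refine ⟨δ, hδ, h.imp (fun h x hx => ?_) fun h x hx => ?_⟩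
      · rw [← h0]
        refine monotoneOn_of_deriv_nonneg (convex_Icc u (u + δ)) hg.continuous.continuousOn
          (hg.differentiable (by simp)).differentiableOn
          (fun y hy => h y (interior_subset hy)) ⟨le_rfl, by linarith⟩ hx hx.1
      · rw [← h0]
        refine antitoneOn_of_deriv_nonpos (convex_Icc u (u + δ)) hg.continuous.continuousOn
          (hg.differentiable (by simp)).differentiableOn
          (fun y hy => h y (interior_subset hy)) ⟨le_rfl, by linarith⟩ hx hx.1
    · exact key2 g hg h0

/-- A smooth function is monotone or antitone on some interval to the right of a point that is
not flat. -/
theorem exists_monotoneOn_right {f : ℝ → ℝ} (hf : ContDiff ℝ ∞ f) {u : ℝ}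
    (hu : ¬ IsFlatPoint f u) :
    ∃ δ : ℝ, 0 < δ ∧ (MonotoneOn f (Icc u (u + δ)) ∨ AntitoneOn f (Icc u (u + δ))) := by
  simp only [IsFlatPoint, not_forall] at hu
  obtain ⟨n, hn, h⟩ := hu
  obtain ⟨n, rfl⟩ := Nat.exists_eq_succ_of_ne_zero hn.ne'
  rw [Nat.succ_eq_add_one, iteratedDeriv_succ'] at h
  obtain ⟨δ, hδ, h⟩ := exists_sign_right (contDiff_infty_iff_deriv.1 hf).2 h
  refine ⟨δ, hδ, h.imp (fun h => ?_) fun h => ?_⟩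
  · exact monotoneOn_of_deriv_nonneg (convex_Icc u (u + δ)) hf.continuous.continuousOn
      (hf.differentiable (by simp)).differentiableOn fun y hy => h y (interior_subset hy)
  · exact antitoneOn_of_deriv_nonpos (convex_Icc u (u + δ)) hf.continuous.continuousOn
      (hf.differentiable (by simp)).differentiableOn fun y hy => h y (interior_subset hy)

end Fermat

/-! ### Maxima and minima of the extension. -/

namespace FermatReal

open Fermat

/-- The increment of `x` is `O(t ^ a)`, so a Taylor expansion of order `n ≥ 1 / a` has remainder
`o(t)`, and at a flat point only its constant term survives. -/
theorem ext_eq_of_isFlatPoint {f : ℝ → ℝ} (hf : ContDiff ℝ ∞ f) {x : FermatReal}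
    (hx : IsFlatPoint f (st x)) : ext f hf x = ofReal (f (st x)) := by
  rw [ext_eq_mk_rep]
  refine mk_eq_mk.2 ⟨by rw [rep_zero], ?_⟩
  obtain ⟨a, ha0, ha1, hO⟩ := (isLittleOhPoly_rep x).exists_isBigO
  obtain ⟨n, hn⟩ := exists_nat_ge (1 / a)
  have hn1 : 1 ≤ a * n := by rwa [div_le_iff₀ ha0, mul_comm] at hn
  rw [rep_zero] at hO
  have hT := (taylor_isLittleO_univ (x₀ := st x) (n := n)
    (hf.of_le (by exact_mod_cast le_top))).comp_tendsto (tendsto_rep x)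
  have hP : (fun t : ℝ => (rep x t - st x) ^ n) =O[𝓝[>] 0] (fun t : ℝ => t) := by
    have h2 := isBigO_rpow_rpow hn1
    refine ((hO.pow n).congr' EventuallyEq.rfl ?_).trans (h2.congr_right fun t => by simp)
    filter_upwards [self_mem_nhdsWithin] with t ht
    rw [← Real.rpow_natCast, ← Real.rpow_mul (le_of_lt ht)]
  refine (hT.trans_isBigO hP).congr_left fun t => ?_
  simp only [Function.comp, taylor_within_apply, iteratedDerivWithin_univ]
  rw [Finset.sum_range_succ', Finset.sum_eq_zero fun k _ => by
    rw [hx (k + 1) k.succ_pos, smul_zero]]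
  simp

/-- The strict bound on the standard part of `y` keeps both representatives eventually in `[u, v]`;
on the left, the order relation with `u` itself suffices, so `x` may be infinitely close to `u`. -/
theorem ext_le_of_monotoneOn {f : ℝ → ℝ} (hf : ContDiff ℝ ∞ f) {u v : ℝ}
    (h : MonotoneOn f (Icc u v)) {x y : FermatReal} (hx : ofReal u ≤ x) (hxy : x ≤ y)
    (hy : st y < v) : ext f hf x ≤ ext f hf y := by
  refine ext_le_ext_of_eventually ?_
  filter_upwards [eventually_rep_le hx, eventually_rep_le hxy,
    (tendsto_rep y).eventually_le_const hy] with t h1 h2 h3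
  rw [rep_ofReal] at h1
  exact h ⟨h1, h2.trans h3⟩ ⟨h1.trans h2, h3⟩ h2

theorem ext_le_of_antitoneOn {f : ℝ → ℝ} (hf : ContDiff ℝ ∞ f) {u v : ℝ}
    (h : AntitoneOn f (Icc u v)) {x y : FermatReal} (hx : ofReal u ≤ x) (hxy : x ≤ y)
    (hy : st y < v) : ext f hf y ≤ ext f hf x := by
  rw [← neg_le_neg_iff, ← ext_neg_comp, ← ext_neg_comp]
  exact ext_le_of_monotoneOn hf.neg h.neg hx hxy hy

/-- On the infinitesimal neighbourhood to the right of a real number, the extension of a smooth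
function is monotone or antitone. -/
theorem ext_monotone_or_antitone_right {f : ℝ → ℝ} (hf : ContDiff ℝ ∞ f) (u : ℝ) :
    (∀ x y : FermatReal, ofReal u ≤ x → x ≤ y → st y = u → ext f hf x ≤ ext f hf y) ∨
    (∀ x y : FermatReal, ofReal u ≤ x → x ≤ y → st y = u → ext f hf y ≤ ext f hf x) := by
  by_cases hu : IsFlatPoint f u
  · refine Or.inl fun x y hx hxy hy => ?_
    have hx' : st x = u := le_antisymm (hy ▸ st_le_st hxy) (st_le_st hx)
    rw [ext_eq_of_isFlatPoint hf (hx'.symm ▸ hu), ext_eq_of_isFlatPoint hf (hy.symm ▸ hu), hx', hy]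
  · obtain ⟨δ, hδ, h⟩ := exists_monotoneOn_right hf hu
    refine h.imp (fun h x y hx hxy hy => ?_) fun h x y hx hxy hy => ?_
    · exact ext_le_of_monotoneOn hf h hx hxy (by linarith)
    · exact ext_le_of_antitoneOn hf h hx hxy (by linarith)

/-- The extension of a smooth function has a maximum on every interval contained in an
infinitesimal right half-neighbourhood. -/
theorem exists_isMaxOn_right {f : ℝ → ℝ} (hf : ContDiff ℝ ∞ f) {u : ℝ} {p q : FermatReal}
    (hp : ofReal u ≤ p) (hpq : p ≤ q) (hq : st q = u) :
    ∃ m ∈ Icc p q, IsMaxOn (ext f hf) (Icc p q) m := by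
  rcases ext_monotone_or_antitone_right hf u with h | h
  · exact ⟨q, ⟨hpq, le_rfl⟩, fun x hx => h x q (hp.trans hx.1) hx.2 hq⟩
  · exact ⟨p, ⟨le_rfl, hpq⟩, fun x hx => h p x hp hx.1
      (le_antisymm (hq ▸ st_le_st hx.2) (st_le_st (hp.trans hx.1)))⟩

/-- Reflection of the domain reduces left half-neighbourhoods to right ones. -/
theorem exists_isMaxOn_neg {f : ℝ → ℝ} (hf : ContDiff ℝ ∞ f) {p q : FermatReal}
    (h : ∃ m ∈ Icc (neg q) (neg p),
      IsMaxOn (ext (fun x => f (-x)) (hf.comp contDiff_neg)) (Icc (neg q) (neg p)) m) :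
    ∃ m ∈ Icc p q, IsMaxOn (ext f hf) (Icc p q) m := by
  obtain ⟨m, hm, hmax⟩ := h
  refine ⟨neg m, ⟨le_neg_iff.1 hm.2, neg_le_iff.1 hm.1⟩, fun x hx => ?_⟩
  have := isMaxOn_iff.1 hmax (neg x) ⟨neg_le_neg hx.2, neg_le_neg hx.1⟩
  rwa [ext_comp_neg, ext_comp_neg, neg_neg] at this

/-- When the common standard part lies inside `[p, q]`, the interval is cut there and the larger of
the two one-sided maxima is taken. -/
theorem exists_isMaxOn_of_st_eq {f : ℝ → ℝ} (hf : ContDiff ℝ ∞ f) {p q : FermatReal}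
    (hpq : p ≤ q) (h : st p = st q) : ∃ m ∈ Icc p q, IsMaxOn (ext f hf) (Icc p q) m := by
  set u := st q with hu
  have hR : ∀ {p : FermatReal}, ofReal u ≤ p → p ≤ q →
      ∃ m ∈ Icc p q, IsMaxOn (ext f hf) (Icc p q) m :=
    fun h1 h2 => exists_isMaxOn_right hf h1 h2 hu.symm
  have hL : ∀ {q : FermatReal}, q ≤ ofReal u → p ≤ q →
      ∃ m ∈ Icc p q, IsMaxOn (ext f hf) (Icc p q) m := by
    intro q h1 h2
    refine exists_isMaxOn_neg hf (exists_isMaxOn_right _ (u := -u) ?_ (neg_le_neg h2) ?_)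
    · rw [← neg_ofReal]; exact neg_le_neg h1
    · rw [st_neg, h]
  rcases le_total (ofReal u) p with h1 | h1
  · exact hR h1 hpq
  rcases le_total q (ofReal u) with h2 | h2
  · exact hL h2 hpq
  obtain ⟨m, hm, hm'⟩ := hR le_rfl h2
  obtain ⟨n, hn, hn'⟩ := hL le_rfl h1
  have hx : ∀ x ∈ Icc p q, ext f hf x ≤ max (ext f hf m) (ext f hf n) := by
    intro x hx
    rcases le_total (ofReal u) x with h3 | h3
    · exact le_max_of_le_left (hm' ⟨h3, hx.2⟩)
    · exact le_max_of_le_right (hn' ⟨hx.1, h3⟩)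
  rcases le_total (ext f hf m) (ext f hf n) with h3 | h3
  · exact ⟨n, ⟨hn.1, hn.2.trans h2⟩, fun x hx' => max_eq_right h3 ▸ hx x hx'⟩
  · exact ⟨m, ⟨h1.trans hm.1, hm.2⟩, fun x hx' => max_eq_left h3 ▸ hx x hx'⟩

/-- If the left endpoint of a real interval is a maximum of `f` on it, then the extension of `f`
has a maximum on the part above `a` of the infinitesimal neighbourhood of that endpoint. -/
theorem exists_max_left_end {f : ℝ → ℝ} (hf : ContDiff ℝ ∞ f) {a : FermatReal} {s : ℝ}
    (has : st a < s) (hmax : ∀ x ∈ Icc (st a) s, f x ≤ f (st a)) :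
    ∃ m, a ≤ m ∧ st m = st a ∧ ∀ x, a ≤ x → st x = st a → ext f hf x ≤ ext f hf m := by
  have hr : ∀ x, ofReal (st a) ≤ x → st x = st a → ext f hf x ≤ ext f hf (ofReal (st a)) := by
    intro x hx hxs
    refine ext_le_ext_of_eventually ?_
    filter_upwards [eventually_rep_le hx,
      (tendsto_rep x).eventually_le_const (hxs ▸ has)] with t h1 h2
    rw [rep_ofReal] at h1 ⊢
    exact hmax _ ⟨h1, h2⟩
  rcases le_total a (ofReal (st a)) with h | h
  · obtain ⟨m, hm, hm'⟩ := exists_isMaxOn_of_st_eq hf h (st_ofReal _).symm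
    refine ⟨m, hm.1, le_antisymm (st_le_st (b := ofReal _) hm.2) (st_le_st hm.1),
      fun x hx hxs => ?_⟩
    rcases le_total x (ofReal (st a)) with h1 | h1
    · exact hm' ⟨hx, h1⟩
    · exact (hr x h1 hxs).trans (hm' ⟨h, le_rfl⟩)
  · refine ⟨a, le_rfl, rfl, fun x hx hxs => ?_⟩
    -- In the monotone case the values lie below `f (st a)` by `hr` and the value at `a` lies above
    -- it, so `a` is a maximum in both cases.
    rcases ext_monotone_or_antitone_right hf (st a) with h1 | h1
    · exact (hr x (h.trans hx) hxs).trans (h1 _ _ le_rfl h rfl)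
    · exact h1 a x h hx hxs

/-- If the right endpoint of a real interval is a maximum of `f` on it, then the extension of `f`
has a maximum on the part below `b` of the infinitesimal neighbourhood of that endpoint. -/
theorem exists_max_right_end {f : ℝ → ℝ} (hf : ContDiff ℝ ∞ f) {b : FermatReal} {r : ℝ}
    (hrb : r < st b) (hmax : ∀ x ∈ Icc r (st b), f x ≤ f (st b)) :
    ∃ m, m ≤ b ∧ st m = st b ∧ ∀ x, x ≤ b → st x = st b → ext f hf x ≤ ext f hf m := by
  obtain ⟨m, hm, hms, h⟩ := exists_max_left_end (hf.comp contDiff_neg) (a := neg b) (s := -r)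
    (by rw [st_neg]; linarith) (fun x hx => by
      rw [st_neg] at hx
      simp only [Function.comp, st_neg, _root_.neg_neg]
      exact hmax _ ⟨by linarith [hx.2], by linarith [hx.1]⟩)
  refine ⟨neg m, neg_le_iff.1 hm, by rw [st_neg, hms, st_neg, _root_.neg_neg], fun x hx hxs => ?_⟩
  have := h (neg x) (neg_le_neg hx) (by rw [st_neg, st_neg, hxs])
  erw [ext_comp_neg, ext_comp_neg, neg_neg] at this
  exact this

/-- For `st a < st b` the points split into those infinitely near `a`, those infinitely near `b`,
and the rest. Each class has a dominating point of `[a, b]`: a local or real maximum if `f` reaches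
its maximum `f u` at a standard part of the class, and otherwise `e`, which wins already by standard
parts. -/
theorem exists_isMaxOn {f : ℝ → ℝ} (hf : ContDiff ℝ ∞ f) {a b : FermatReal} (hab : a ≤ b) :
    ∃ m ∈ Icc a b, IsMaxOn (ext f hf) (Icc a b) m := by
  rcases (st_le_st hab).eq_or_lt with hst | hst
  · exact exists_isMaxOn_of_st_eq hf hab hst
  obtain ⟨u, hu, hmax⟩ := isCompact_Icc.exists_isMaxOn (nonempty_Icc.2 hst.le)
    hf.continuous.continuousOn
  have hmax' : ∀ v ∈ Icc (st a) (st b), f v ≤ f u := fun v hv => hmax hv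
  obtain ⟨e, he, heu⟩ : ∃ e ∈ Icc a b, st e = u := by
    rcases hu.1.eq_or_lt with h | h
    · exact ⟨a, ⟨le_rfl, hab⟩, h⟩
    rcases hu.2.eq_or_lt with h' | h'
    · exact ⟨b, ⟨hab, le_rfl⟩, h'.symm⟩
    · exact ⟨ofReal u, ⟨(lt_of_st_lt (b := ofReal u) h).le,
        (lt_of_st_lt (a := ofReal u) h').le⟩, rfl⟩
  have hlt : ∀ x, f (st x) < f u → ext f hf x ≤ ext f hf e := fun x hx =>
    (lt_of_st_lt (by rwa [st_ext, st_ext, heu])).le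
  obtain ⟨m₁, hm₁, h₁⟩ : ∃ m ∈ Icc a b, ∀ x ∈ Icc a b, st x = st a → ext f hf x ≤ ext f hf m := by
    rcases (hmax' _ (left_mem_Icc.2 hst.le)).eq_or_lt with h | h
    · obtain ⟨m, h1, h2, h3⟩ := exists_max_left_end hf hst (fun x hx => h ▸ hmax' x hx)
      exact ⟨m, ⟨h1, (lt_of_st_lt (h2 ▸ hst)).le⟩, fun x hx hxa => h3 x hx.1 hxa⟩
    · exact ⟨e, he, fun x _ hxa => hlt x (hxa ▸ h)⟩
  obtain ⟨m₂, hm₂, h₂⟩ : ∃ m ∈ Icc a b, ∀ x ∈ Icc a b, st x = st b → ext f hf x ≤ ext f hf m := by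
    rcases (hmax' _ (right_mem_Icc.2 hst.le)).eq_or_lt with h | h
    · obtain ⟨m, h1, h2, h3⟩ := exists_max_right_end hf hst (fun x hx => h ▸ hmax' x hx)
      exact ⟨m, ⟨(lt_of_st_lt (h2 ▸ hst)).le, h1⟩, fun x hx hxa => h3 x hx.2 hxa⟩
    · exact ⟨e, he, fun x _ hxa => hlt x (hxa ▸ h)⟩
  obtain ⟨m₃, hm₃, h₃⟩ : ∃ m ∈ Icc a b, ∀ x, st x ∈ Ioo (st a) (st b) →
      ext f hf x ≤ ext f hf m := by
    by_cases h : ∃ v ∈ Ioo (st a) (st b), f v = f u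
    · obtain ⟨v, hv, hvu⟩ := h
      refine ⟨ofReal v, ⟨(lt_of_st_lt (b := ofReal v) hv.1).le,
        (lt_of_st_lt (a := ofReal v) hv.2).le⟩, fun x hx => ?_⟩
      refine ext_le_ext_of_eventually ?_
      filter_upwards [(tendsto_rep x).eventually (Ioo_mem_nhds hx.1 hx.2)] with t ht
      rw [rep_ofReal, hvu]
      exact hmax' _ (Ioo_subset_Icc_self ht)
    · exact ⟨e, he, fun x hx => hlt x (lt_of_le_of_ne (hmax' _ (Ioo_subset_Icc_self hx))
        fun h' => h ⟨_, hx, h'⟩)⟩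
  have hall : ∀ x ∈ Icc a b, ext f hf x ≤ ext f hf m₁ ∨ ext f hf x ≤ ext f hf m₂ ∨
      ext f hf x ≤ ext f hf m₃ := by
    intro x hx
    rcases (st_le_st hx.1).eq_or_lt with h | h
    · exact Or.inl (h₁ x hx h.symm)
    rcases (st_le_st hx.2).eq_or_lt with h' | h'
    · exact Or.inr (Or.inl (h₂ x hx h'))
    · exact Or.inr (Or.inr (h₃ x ⟨h, h'⟩))
  obtain ⟨m, hm, hm'⟩ := ({m₁, m₂, m₃} : Set FermatReal).toFinite.exists_maximalFor (ext f hf) _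
    (insert_nonempty _ _)
  have hle : ∀ y ∈ ({m₁, m₂, m₃} : Set FermatReal), ext f hf y ≤ ext f hf m := fun y hy =>
    (le_total (ext f hf y) (ext f hf m)).elim id fun h => hm' hy h
  refine ⟨m, ?_, fun x hx => ?_⟩
  · rcases hm with rfl | rfl | rfl <;> assumption
  · rcases hall x hx with h | h | h
    exacts [h.trans (hle _ (by simp)), h.trans (hle _ (by simp)), h.trans (hle _ (by simp))]

theorem exists_isMinOn {f : ℝ → ℝ} (hf : ContDiff ℝ ∞ f) {a b : FermatReal} (hab : a ≤ b) :
    ∃ m ∈ Icc a b, IsMinOn (ext f hf) (Icc a b) m := by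
  obtain ⟨m, hm, h⟩ := exists_isMaxOn hf.neg hab
  refine ⟨m, hm, fun x hx => ?_⟩
  have := isMaxOn_iff.1 h x hx
  rwa [ext_neg_comp, ext_neg_comp, neg_le_neg_iff] at this

end FermatReal

/-! ### Solving `f x = y` infinitesimally near a non-flat point. -/

namespace Fermat

/-- Taylor's formula at a point that is not flat, with the first non-constant monomial factored
out. -/
theorem exists_taylor_factor {f : ℝ → ℝ} (hf : ContDiff ℝ ∞ f) {u : ℝ}
    (hu : ¬ IsFlatPoint f u) : ∃ (n : ℕ) (c : ℝ), 0 < n ∧ c ≠ 0 ∧ ∀ K : ℕ, ∃ Q : ℝ → ℝ,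
      ContDiff ℝ ∞ Q ∧ Q 0 = c ∧
      (fun x => f x - (f u + (x - u) ^ n * Q (x - u))) =o[𝓝 u] fun x => (x - u) ^ (n + K) := by
  classical
  simp only [IsFlatPoint, not_forall] at hu
  have hex : ∃ n, 0 < n ∧ iteratedDeriv n f u ≠ 0 := by simpa using hu
  obtain ⟨hn, hne⟩ := Nat.find_spec hex
  have hmin : ∀ k < Nat.find hex, 0 < k → iteratedDeriv k f u = 0 := fun k hk hk0 => by
    by_contra h
    exact Nat.find_min hex hk ⟨hk0, h⟩
  generalize Nat.find hex = n at hn hne hmin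
  -- `n` is the least positive order with non-zero derivative. It and `c` do not depend on the
  -- precision `K`, which can thus be chosen in terms of `n`.
  refine ⟨n, (n.factorial : ℝ)⁻¹ * iteratedDeriv n f u, hn,
    mul_ne_zero (by positivity) hne, fun K => ?_⟩
  refine ⟨fun h => ∑ j ∈ Finset.range (K + 1),
    (((n + j).factorial : ℝ)⁻¹ * iteratedDeriv (n + j) f u) * h ^ j, by fun_prop, ?_, ?_⟩
  · beta_reduce
    rw [Finset.sum_range_succ', Finset.sum_eq_zero fun k _ => by simp]
    simp
  · refine (taylor_isLittleO_univ (x₀ := u) (n := n + K)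
      (hf.of_le (by exact_mod_cast le_top))).congr_left fun x => ?_
    congr 1
    simp only [taylor_within_apply, iteratedDerivWithin_univ]
    rw [add_assoc, Finset.sum_range_add, Finset.mul_sum]
    congr 1
    · obtain ⟨m, rfl⟩ := Nat.exists_eq_succ_of_ne_zero hn.ne'
      rw [Finset.sum_range_succ', Finset.sum_eq_zero fun k hk => by
        rw [hmin (k + 1) (by simpa using hk) k.succ_pos, smul_zero]]
      simp
    · refine Finset.sum_congr rfl fun j _ => ?_
      rw [smul_eq_mul, pow_add]; ring

/-- A smooth local right inverse. -/
theorem exists_contDiffAt_inverse {φ : ℝ → ℝ} {c : ℝ} (hφ : ContDiffAt ℝ ∞ φ 0)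
    (hc : HasDerivAt φ c 0) (hc0 : c ≠ 0) (h0 : φ 0 = 0) :
    ∃ ψ : ℝ → ℝ, ContDiffAt ℝ ∞ ψ 0 ∧ ψ 0 = 0 ∧ ∀ᶠ w in 𝓝 0, φ (ψ w) = w := by
  have h1 := hc.hasFDerivAt_equiv hc0
  have h2 := hφ.hasStrictFDerivAt' h1 (by simp)
  refine ⟨hφ.localInverse h1 (by simp), ?_, ?_, ?_⟩
  · simpa only [h0] using hφ.to_localInverse h1 (by simp)
  · simpa only [h0] using hφ.localInverse_apply_image h1 (by simp)
  · have h3 := h2.eventually_right_inverse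
    rw [h0] at h3
    exact h3

end Fermat

namespace FermatReal

open Fermat

/-- The dictionary order makes the leading coefficient of `y - v` positive. Splitting off its
monomial leaves a factor `W` to which real powers apply smoothly. -/
theorem exists_rep_eq_of_ofReal_lt {y : FermatReal} {v : ℝ} (hy : ofReal v < y) (hv : st y = v) :
    ∃ (m : ℝ) (W : ℝ → ℝ), 0 < m ∧ IsLittleOhPoly W ∧ 0 < W 0 ∧
      ∀ t : ℝ, 0 < t → rep y t = v + t ^ m * W t := by
  rcases lt_iff_decomp.1 hy with h | ⟨-, i, hi, hlt⟩
  · exact absurd h (by rw [st_ofReal, hv]; exact lt_irrefl _)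
  · rw [decomp_ofReal] at hi hlt
    obtain ⟨W, hW, hW0, hWt⟩ := exists_factor_leading (decomp y).2 i
      (fun j hj => by simpa using (hi j hj).symm)
    refine ⟨i, W, i.2.1, hW, by rw [hW0]; simpa using hlt, fun t ht => ?_⟩
    rw [← hWt t ht, rep, decompFun, decomp_fst, hv]

/-- If `f u ≤ f x` for `x` to the right of a point `u` that is not flat, then the extension of `f`
takes on the right half-neighbourhood of `u` all values infinitesimally above `f u`. -/
theorem exists_ext_eq_right {f : ℝ → ℝ} (hf : ContDiff ℝ ∞ f) {u : ℝ} (hu : ¬ IsFlatPoint f u)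
    (hle : ∀ᶠ x in 𝓝[>] u, f u ≤ f x) {y : FermatReal} (hy : ofReal (f u) < y)
    (hyu : st y = f u) : ∃ x : FermatReal, ofReal u ≤ x ∧ st x = u ∧ ext f hf x = y := by
  obtain ⟨n, c, hn, hc, hT⟩ := exists_taylor_factor hf hu
  obtain ⟨m, W, hm, hW, hW0, hWt⟩ := exists_rep_eq_of_ofReal_lt hy hyu
  have hn0 : (0 : ℝ) < n := by exact_mod_cast hn
  -- A negative leading coefficient would give `f x < f u` just to the right of `u`.
  have hcpos : 0 < c := by
    by_contra hneg
    have hneg : c < 0 := lt_of_le_of_ne (not_lt.1 hneg) hc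
    obtain ⟨Q, hQ, hQ0, ho⟩ := hT 0
    have h1 : Tendsto (fun x => Q (x - u)) (𝓝[>] u) (𝓝 c) := by
      have : ContinuousAt (fun x => Q (x - u)) u :=
        (hQ.continuous.comp (continuous_id.sub continuous_const)).continuousAt
      have h2 := this.tendsto.mono_left (nhdsWithin_le_nhds (s := Ioi u))
      simpa [hQ0] using h2
    have h2 := (ho.mono (nhdsWithin_le_nhds (s := Ioi u))).def (show 0 < -c / 4 by linarith)
    have h3 : ∀ᶠ x : ℝ in 𝓝[>] u, False := by
      filter_upwards [hle, h1.eventually_le_const (show c < c / 2 by linarith), h2,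
        self_mem_nhdsWithin] with x h3 h4 h5 (h6 : u < x)
      have h7 : 0 < (x - u) ^ n := pow_pos (sub_pos.2 h6) n
      rw [add_zero, Real.norm_eq_abs, Real.norm_of_nonneg h7.le, abs_le] at h5
      nlinarith
    exact h3.exists.choose_spec
  -- The solution will satisfy `x - u = O(t ^ (m / n))`; this `K` gives `(m / n) * (n + K) ≥ 1`, so
  -- the Taylor remainder is `o(t)`.
  obtain ⟨K, hK⟩ := exists_nat_ge (n / m)
  obtain ⟨Q, hQ, hQ0, ho⟩ := hT K
  have hQne : Q 0 ≠ 0 := hQ0 ▸ hc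
  -- `h * Q h ^ (1 / n)` is an `n`-th root of `h ^ n * Q h` for small `h ≥ 0`. Unlike the latter it
  -- has non-zero derivative at 0 even for `n > 1`, so it can be inverted smoothly and applied to
  -- the root `w` of `t ^ m * W t`.
  obtain ⟨ψ, hψ, hψ0, hφψ⟩ := exists_contDiffAt_inverse
    (φ := fun h => h * Q h ^ (1 / n : ℝ)) (c := c ^ (1 / n : ℝ))
    (contDiffAt_id.mul (hQ.contDiffAt.rpow_const_of_ne hQne))
    (by
      have h1 : DifferentiableAt ℝ (fun h => Q h ^ (1 / n : ℝ)) 0 :=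
        (hQ.contDiffAt.rpow_const_of_ne hQne).differentiableAt (by simp)
      simpa [hQ0] using (hasDerivAt_id' (0 : ℝ)).fun_mul h1.hasDerivAt)
    (Real.rpow_pos_of_pos hcpos _).ne' (by simp)
  have hmn : 0 < m / n := div_pos hm hn0
  have hWp : IsLittleOhPoly (fun t => W t ^ (1 / n : ℝ)) :=
    hW.comp_contDiffAt (F := fun s => s ^ (1 / n : ℝ)) (contDiffAt_id.rpow_const_of_ne hW0.ne')
  set w : ℝ → ℝ := fun t => t ^ (m / n : ℝ) * W t ^ (1 / n : ℝ) with hw_def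
  have hw : IsLittleOhPoly w := by
    simpa only [one_mul] using (isLittleOhPoly_const_mul_rpow 1 hmn).mul hWp
  have hw0 : w 0 = 0 := by simp [hw_def, Real.zero_rpow hmn.ne']
  have hwO : w =O[𝓝[>] 0] fun t : ℝ => t ^ (m / n : ℝ) := by
    simpa [hw_def] using (isBigO_refl (fun t : ℝ => t ^ (m / n : ℝ)) (𝓝[>] 0)).mul
      (hWp.tendsto.isBigO_one ℝ)
  have hwt : Tendsto w (𝓝[>] 0) (𝓝 0) := by simpa only [hw0] using hw.tendsto
  have hh : IsLittleOhPoly (fun t => ψ (w t)) := hw.comp_contDiffAt (by rwa [hw0])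
  have hht : Tendsto (fun t => ψ (w t)) (𝓝[>] 0) (𝓝 0) := by
    simpa only [hw0, hψ0] using hh.tendsto
  have hhO : (fun t => ψ (w t)) =O[𝓝[>] 0] fun t : ℝ => t ^ (m / n : ℝ) := by
    have h1 := ((hψ.differentiableAt (by simp)).isBigO_sub).comp_tendsto hwt
    simp only [Function.comp_def, hψ0, sub_zero] at h1
    exact h1.trans hwO
  have hev : ∀ᶠ t in 𝓝[>] 0, 0 ≤ ψ (w t) ∧ ψ (w t) ^ n * Q (ψ (w t)) = t ^ m * W t := by
    have hQt : Tendsto (fun t => Q (ψ (w t))) (𝓝[>] 0) (𝓝 c) :=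
      hQ0 ▸ (hQ.continuous.tendsto 0).comp hht
    filter_upwards [hwt.eventually hφψ, hQt.eventually_const_lt hcpos,
      hW.tendsto.eventually_const_lt hW0, self_mem_nhdsWithin] with t h1 h2 h3 (h4 : 0 < t)
    have h5 : 0 < Q (ψ (w t)) ^ (1 / n : ℝ) := Real.rpow_pos_of_pos h2 _
    have h6 : 0 ≤ w t := by positivity
    have hroot : ∀ s : ℝ, 0 ≤ s → (s ^ (1 / n : ℝ)) ^ n = s := fun s hs => by
      rw [one_div, Real.rpow_inv_natCast_pow hs hn.ne']
    refine ⟨?_, ?_⟩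
    · rw [← h1] at h6
      exact nonneg_of_mul_nonneg_left h6 h5
    · have h7 := congrArg (· ^ n) h1
      simp only [hw_def] at h7
      rw [mul_pow, mul_pow, hroot _ h3.le] at h7
      erw [hroot _ h2.le] at h7
      rw [h7, ← Real.rpow_natCast, ← Real.rpow_mul h4.le, div_mul_cancel₀ _ hn0.ne']
  have hx : IsLittleOhPoly (fun t => u + ψ (w t)) := (isLittleOhPoly_const u).add hh
  have hxt : Tendsto (fun t => u + ψ (w t)) (𝓝[>] 0) (𝓝 u) := by
    simpa using hht.const_add u
  refine ⟨mk _ hx, mk_le_mk (hev.mono fun t ht => by linarith [ht.1]),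
    by simp [st_mk, hw0, hψ0], ?_⟩
  rw [ext_mk, ← mk_rep y, mk_eq_mk]
  refine ⟨by rw [rep_zero, hyu, hw0, hψ0, add_zero], ?_⟩
  have hP : (fun t => ψ (w t) ^ (n + K)) =O[𝓝[>] 0] fun t : ℝ => t := by
    have h1 : 1 ≤ m / n * (n + K : ℕ) := by
      rw [div_le_iff₀ hm] at hK
      rw [div_mul_eq_mul_div, le_div_iff₀ hn0]
      push_cast
      nlinarith
    refine ((hhO.pow (n + K)).congr' EventuallyEq.rfl ?_).trans
      ((isBigO_rpow_rpow h1).congr_right fun t => by simp)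
    filter_upwards [self_mem_nhdsWithin] with t ht
    rw [← Real.rpow_natCast, ← Real.rpow_mul (le_of_lt ht)]
  have h1 := ho.comp_tendsto hxt
  simp only [Function.comp_def, add_sub_cancel_left] at h1
  refine (h1.trans_isBigO hP).congr' ?_ EventuallyEq.rfl
  filter_upwards [hev, self_mem_nhdsWithin] with t h2 h3
  rw [hWt t h3, h2.2]

end FermatReal

/-! ### The intermediate value theorem for the extension. -/

namespace FermatReal

open Fermat

theorem ofReal_le_ofReal {r s : ℝ} (h : r ≤ s) : ofReal r ≤ ofReal s :=
  mk_le_mk (Eventually.of_forall fun _ => h)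

/-- The extension of `f` takes on `[p, q]` all values between those at `p` and at `q`. -/
def HasIVT (f : ℝ → ℝ) (hf : ContDiff ℝ ∞ f) (p q : FermatReal) : Prop :=
  ∀ y ∈ uIcc (ext f hf p) (ext f hf q), ∃ x ∈ Icc p q, ext f hf x = y

section

variable {f : ℝ → ℝ} {hf : ContDiff ℝ ∞ f} {p q r : FermatReal}

/-- Unordered intervals allow gluing without knowing how the three values compare. -/
theorem HasIVT.trans (h₁ : HasIVT f hf p q) (h₂ : HasIVT f hf q r) (hpq : p ≤ q) (hqr : q ≤ r) :
    HasIVT f hf p r := by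
  intro y hy
  rcases uIcc_subset_uIcc_union_uIcc (b := ext f hf q) hy with h | h
  · obtain ⟨x, hx, hxy⟩ := h₁ y h
    exact ⟨x, ⟨hx.1, hx.2.trans hqr⟩, hxy⟩
  · obtain ⟨x, hx, hxy⟩ := h₂ y h
    exact ⟨x, ⟨hpq.trans hx.1, hx.2⟩, hxy⟩

theorem neg_mem_uIcc {x y z : FermatReal} (h : x ∈ uIcc y z) : neg x ∈ uIcc (neg y) (neg z) := by
  rw [mem_uIcc] at h ⊢
  exact h.symm.imp (fun h => ⟨neg_le_neg h.2, neg_le_neg h.1⟩)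
    fun h => ⟨neg_le_neg h.2, neg_le_neg h.1⟩

theorem HasIVT.of_neg (h : HasIVT (fun x => -f x) hf.neg p q) : HasIVT f hf p q := by
  intro y hy
  obtain ⟨x, hx, hxy⟩ := h (neg y) (by
    rw [ext_neg_comp hf, ext_neg_comp hf]; exact neg_mem_uIcc hy)
  rw [ext_neg_comp hf] at hxy
  exact ⟨x, hx, by rw [← neg_neg (ext f hf x), hxy, neg_neg]⟩

theorem HasIVT.of_comp_neg
    (h : HasIVT (fun x => f (-x)) (hf.comp contDiff_neg) (neg q) (neg p)) :
    HasIVT f hf p q := by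
  intro y hy
  obtain ⟨x, hx, hxy⟩ := h y (by
    rwa [ext_comp_neg hf, ext_comp_neg hf, neg_neg, neg_neg, uIcc_comm])
  rw [ext_comp_neg hf] at hxy
  exact ⟨neg x, ⟨le_neg_iff.1 hx.2, neg_le_iff.1 hx.1⟩, hxy⟩

theorem not_isFlatPoint_neg (h : ∀ u, ¬ IsFlatPoint f u) (u : ℝ) :
    ¬ IsFlatPoint (fun x => -f x) u := by
  refine fun hu => h u fun n hn => ?_
  simpa [iteratedDeriv_fun_neg] using hu n hn

theorem not_isFlatPoint_comp_neg (h : ∀ u, ¬ IsFlatPoint f u) (u : ℝ) :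
    ¬ IsFlatPoint (fun x => f (-x)) u := by
  refine fun hu => h (-u) fun n hn => ?_
  simpa [iteratedDeriv_comp_neg] using hu n hn

/-- A preimage found to the left of `p` has value at most that at `p`, so the intended value is the
one at `p` itself. -/
theorem hasIVT_of_monotoneOn {u v : ℝ} (hmono : MonotoneOn f (Icc u v)) (hup : ofReal u ≤ p)
    (hqv : st q < v) (hpq : p ≤ q) (h : HasIVT f hf (ofReal u) q) : HasIVT f hf p q := by
  have hm : ∀ {x y}, ofReal u ≤ x → x ≤ y → st y < v → ext f hf x ≤ ext f hf y :=
    fun h1 h2 h3 => ext_le_of_monotoneOn hf hmono h1 h2 h3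
  have hpv : st p < v := (st_le_st hpq).trans_lt hqv
  intro y hy
  rw [uIcc_of_le (hm hup hpq hqv)] at hy
  obtain ⟨x, hx, hxy⟩ := h y (by
    rw [uIcc_of_le (hm le_rfl (hup.trans hpq) hqv)]
    exact ⟨(hm le_rfl hup hpv).trans hy.1, hy.2⟩)
  rcases le_total p x with h1 | h1
  · exact ⟨x, ⟨h1, hx.2⟩, hxy⟩
  · exact ⟨p, ⟨le_rfl, hpq⟩, le_antisymm hy.1 (hxy ▸ hm hx.1 h1 hpv)⟩

/-- The intermediate value property on an infinitesimal right half-neighbourhood. -/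
theorem hasIVT_right {u : ℝ} (hflat : ∀ u, ¬ IsFlatPoint f u) (hup : ofReal u ≤ p)
    (hpq : p ≤ q) (hq : st q = u) : HasIVT f hf p q := by
  obtain ⟨δ, hδ, h⟩ := exists_monotoneOn_right hf (hflat u)
  wlog hmono : MonotoneOn f (Icc u (u + δ)) generalizing f
  · have hanti := h.resolve_left hmono
    exact (this (not_isFlatPoint_neg hflat) (Or.inl hanti.neg) hanti.neg).of_neg
  have hlt : st q < u + δ := by linarith
  refine hasIVT_of_monotoneOn hmono hup hlt hpq fun y hy => ?_
  have huq : ofReal u ≤ q := hup.trans hpq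
  rw [uIcc_of_le (ext_le_of_monotoneOn hf hmono le_rfl huq hlt)] at hy
  rcases hy.1.eq_or_lt with h1 | h1
  · exact ⟨_, ⟨le_rfl, huq⟩, h1⟩
  have hyu : st y = f u := le_antisymm (by simpa [st_ext, hq] using st_le_st hy.2)
    (by simpa [st_ext, st_ofReal] using st_le_st hy.1)
  obtain ⟨x, hx, hxu, hxy⟩ := exists_ext_eq_right hf (hflat u) (by
    filter_upwards [Ioo_mem_nhdsGT (show u < u + δ by linarith)] with x hx
    exact hmono ⟨le_rfl, by linarith⟩ (Ioo_subset_Icc_self hx) hx.1.le) h1 hyu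
  -- A solution beyond `q` forces `y` to be the value at `q`, by monotonicity.
  rcases le_total x q with h2 | h2
  · exact ⟨x, ⟨hx, h2⟩, hxy⟩
  · exact ⟨q, ⟨huq, le_rfl⟩,
      le_antisymm (hxy ▸ ext_le_of_monotoneOn hf hmono huq h2 (by linarith)) hy.2⟩

/-- The intermediate value property on an infinitesimal neighbourhood. -/
theorem hasIVT_of_st_eq (hflat : ∀ u, ¬ IsFlatPoint f u) (hpq : p ≤ q) (h : st p = st q) :
    HasIVT f hf p q := by
  have hL : ∀ {q}, q ≤ ofReal (st p) → p ≤ q → HasIVT f hf p q := fun {q} h1 h2 =>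
    (hasIVT_right (u := -st p) (not_isFlatPoint_comp_neg hflat)
      (by rw [← neg_ofReal]; exact neg_le_neg h1) (neg_le_neg h2) (st_neg p)).of_comp_neg
  rcases le_total (ofReal (st p)) p with h1 | h1
  · exact hasIVT_right hflat h1 hpq h.symm
  rcases le_total q (ofReal (st p)) with h2 | h2
  · exact hL h2 hpq
  · exact (hL le_rfl h1).trans (hasIVT_right hflat le_rfl h2 h.symm) h1 h2

/-- Not every real preimage of `st y` will do: `f` must not drop below `st y` to its right. The last
point of `[r, s]` with `f ≤ st y` has this property, and `exists_ext_eq_right` applies there. -/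
theorem exists_ext_eq_of_st_lt (hflat : ∀ u, ¬ IsFlatPoint f u) {r s : ℝ} (hrs : r ≤ s)
    {y : FermatReal} (hy : ofReal (st y) < y) (h₁ : ofReal (f r) ≤ y) (h₂ : y ≤ ofReal (f s)) :
    ∃ x ∈ Icc (ofReal r) (ofReal s), ext f hf x = y := by
  have hr : f r ≤ st y := st_le_st h₁
  have hs : st y < f s := by
    by_contra h
    exact absurd (h₂.trans (ofReal_le_ofReal (not_lt.1 h))) (not_le.2 hy)
  obtain ⟨u, ⟨hu, hfu⟩, hmax⟩ := (isCompact_Icc.inter_right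
    (isClosed_le hf.continuous continuous_const)).exists_isGreatest
      (⟨r, left_mem_Icc.2 hrs, hr⟩ : (Icc r s ∩ {x | f x ≤ st y}).Nonempty)
  have hfu' : f u ≤ st y := hfu
  have hus : u < s := lt_of_le_of_ne hu.2 (by rintro rfl; linarith)
  have heq : f u = st y := by
    obtain ⟨x, hx, hxv⟩ := intermediate_value_Icc hus.le hf.continuous.continuousOn ⟨hfu', hs.le⟩
    have : x ≤ u := hmax ⟨⟨hu.1.trans hx.1, hx.2⟩, hxv.le⟩
    rw [← hxv, le_antisymm this hx.1]
  obtain ⟨x, hx, hxu, hxy⟩ := exists_ext_eq_right hf (hflat u) (by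
    filter_upwards [Ioo_mem_nhdsGT hus] with x hx
    by_contra h
    exact absurd (hmax ⟨⟨hu.1.trans hx.1.le, hx.2.le⟩, ((not_le.1 h).le.trans hfu')⟩)
      (not_le.2 hx.1)) (heq.symm ▸ hy) heq.symm
  exact ⟨x, ⟨(ofReal_le_ofReal hu.1).trans hx, (lt_of_st_lt (b := ofReal s) (hxu ▸ hus)).le⟩, hxy⟩

/-- The intermediate value property between real numbers. -/
theorem hasIVT_ofReal (hflat : ∀ u, ¬ IsFlatPoint f u) {r s : ℝ} (hrs : r ≤ s) :
    HasIVT f hf (ofReal r) (ofReal s) := by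
  wlog hle : f r ≤ f s generalizing f
  · exact (this (not_isFlatPoint_neg hflat) (by linarith)).of_neg
  intro y hy
  rw [ext_ofReal, ext_ofReal, uIcc_of_le (ofReal_le_ofReal hle)] at hy
  rcases lt_trichotomy (ofReal (st y)) y with h | h | h
  · exact exists_ext_eq_of_st_lt hflat hrs h hy.1 hy.2
  · obtain ⟨x, hx, hxy⟩ := intermediate_value_Icc hrs hf.continuous.continuousOn
      (show st y ∈ Icc (f r) (f s) from ⟨st_le_st hy.1, st_le_st hy.2⟩)
    exact ⟨ofReal x, ⟨ofReal_le_ofReal hx.1, ofReal_le_ofReal hx.2⟩, by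
      rw [ext_ofReal, hxy, h]⟩
  -- Reflecting both domain and codomain puts `y` above its standard part and preserves the order of
  -- the end values.
  · obtain ⟨x, hx, hxy⟩ := exists_ext_eq_of_st_lt (f := fun x => -f (-x)) (y := neg y)
      (hf := (hf.comp contDiff_neg).neg)
      (not_isFlatPoint_neg (not_isFlatPoint_comp_neg hflat)) (_root_.neg_le_neg hrs)
      (by
        rw [st_neg, ← neg_ofReal]
        exact lt_of_not_ge fun h' => absurd (neg_le_neg_iff.1 h') (not_le.2 h))
      (by simpa [← neg_ofReal] using neg_le_neg hy.2)
      (by simpa [← neg_ofReal] using neg_le_neg hy.1)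
    refine ⟨neg x, ⟨?_, ?_⟩, ?_⟩
    · rw [← neg_ofReal s, ← neg_ofReal r] at hx; exact le_neg_iff.1 hx.2
    · rw [← neg_ofReal s, ← neg_ofReal r] at hx; exact neg_le_iff.1 hx.1
    · rw [ext_neg_comp (f := fun x => f (-x)) (hf.comp contDiff_neg), ext_comp_neg hf] at hxy
      rw [← neg_neg (ext f hf (neg x)), hxy, neg_neg]

/-- If `p` lies below its standard part, the path goes through that real number. If above, the
property on `[st p, r]` is restricted to `[p, r]`, with `r` real and in the range where `f` is
monotone or antitone. -/
theorem hasIVT_to_ofReal (hflat : ∀ u, ¬ IsFlatPoint f u) {s : ℝ} (hs : st p < s) :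
    HasIVT f hf p (ofReal s) := by
  have hps : p ≤ ofReal s := (lt_of_st_lt (b := ofReal s) hs).le
  rcases le_total p (ofReal (st p)) with h | h
  · exact (hasIVT_of_st_eq hflat h (st_ofReal _).symm).trans (hasIVT_ofReal hflat hs.le) h
      (ofReal_le_ofReal hs.le)
  obtain ⟨δ, hδ, hm⟩ := exists_monotoneOn_right hf (hflat (st p))
  obtain ⟨r, hpr, hr⟩ := exists_between (show st p < min s (st p + δ) by simp [hs, hδ])
  rw [lt_min_iff] at hr
  have hpr' : p ≤ ofReal r := (lt_of_st_lt (b := ofReal r) hpr).le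
  suffices h1 : HasIVT f hf p (ofReal r) from
    h1.trans (hasIVT_ofReal hflat hr.1.le) hpr' (ofReal_le_ofReal hr.1.le)
  rcases hm with hm | hm
  · exact hasIVT_of_monotoneOn (q := ofReal r) hm h hr.2 hpr' (hasIVT_ofReal hflat hpr.le)
  · exact (hasIVT_of_monotoneOn (q := ofReal r) hm.neg h hr.2 hpr'
      (hasIVT_ofReal (not_isFlatPoint_neg hflat) hpr.le)).of_neg

/-- The intermediate value theorem for extensions of smooth functions without flat points. -/
theorem hasIVT (hflat : ∀ u, ¬ IsFlatPoint f u) (hpq : p ≤ q) : HasIVT f hf p q := by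
  rcases (st_le_st hpq).eq_or_lt with h | h
  · exact hasIVT_of_st_eq hflat hpq h
  · obtain ⟨s, hps, hsq⟩ := exists_between h
    refine (hasIVT_to_ofReal hflat hps).trans (HasIVT.of_comp_neg ?_)
      (lt_of_st_lt (b := ofReal s) hps).le (lt_of_st_lt (a := ofReal s) hsq).le
    rw [neg_ofReal]
    exact hasIVT_to_ofReal (not_isFlatPoint_comp_neg hflat) (by rw [st_neg]; linarith)

/-! ### Non-degeneracy of the image. -/

/-- Strict differentiability with non-zero derivative bounds the difference of the representatives
by a multiple of the difference of their images, which is `o(t)`. -/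
theorem eq_of_ext_eq {a b : FermatReal} (hab : st a = st b) (hd : deriv f (st a) ≠ 0)
    (h : ext f hf a = ext f hf b) : a = b := by
  rw [ext_eq_mk_rep, ext_eq_mk_rep, mk_eq_mk] at h
  rw [← mk_rep a, ← mk_rep b, mk_eq_mk]
  refine ⟨by rw [rep_zero, rep_zero, hab], ?_⟩
  have hs : HasStrictDerivAt f (deriv f (st a)) (st a) :=
    hf.contDiffAt.hasStrictDerivAt (by simp)
  have hxy : Tendsto (fun t => (rep a t, rep b t)) (𝓝[>] 0) (𝓝 (st a, st a)) :=
    (tendsto_rep a).prodMk_nhds (hab ▸ tendsto_rep b)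
  have h1 := hs.hasStrictFDerivAt.isLittleO.comp_tendsto hxy
  simp only [Function.comp_def, ContinuousLinearMap.toSpanSingleton_apply, smul_eq_mul] at h1
  have h2 : (fun t => rep a t - rep b t) =O[𝓝[>] 0]
      fun t => (rep a t - rep b t) * deriv f (st a) :=
    (isBigO_self_const_mul hd _ _).congr_right fun t => mul_comm _ _
  have h3 := (h1.trans_isBigO h2).right_isBigO_add
  simp only [sub_add_cancel] at h3
  exact (h2.trans h3).trans_isLittleO h.2

/-- A constant extension contradicts injectivity when the standard parts agree; when they differ,
`f` is constant near a real point between them, which is then flat. -/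
theorem exists_ext_ne {a b : FermatReal} (hflat : ∀ u, ¬ IsFlatPoint f u) (hab : a < b)
    (h : st a < st b ∨ deriv f (st a) ≠ 0) (c : FermatReal) : ∃ x ∈ Icc a b, ext f hf x ≠ c := by
  by_contra! hc
  rcases (st_le_st hab.le).eq_or_lt with h1 | h1
  · have hd := h.resolve_left (by rw [h1]; exact lt_irrefl _)
    exact hab.ne (eq_of_ext_eq h1 hd
      ((hc a ⟨le_rfl, hab.le⟩).trans (hc b ⟨hab.le, le_rfl⟩).symm))
  · obtain ⟨u, hu1, hu2⟩ := exists_between h1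
    refine hflat u fun n hn => ?_
    have heq : f =ᶠ[𝓝 u] fun _ => st c := by
      filter_upwards [Ioo_mem_nhds hu1 hu2] with x hx
      rw [← hc (ofReal x) ⟨(lt_of_st_lt (b := ofReal x) hx.1).le,
        (lt_of_st_lt (a := ofReal x) hx.2).le⟩]
      rfl
    rw [heq.iteratedDeriv_eq, iteratedDeriv_const, if_neg hn.ne']

end

end FermatReal

theorem mainTheorem10 (f : ℝ → ℝ) (hf : ContDiff ℝ ∞ f) (a b : FermatReal) (hab : a < b) :
    (∃ p ∈ Set.Icc a b, IsMaxOn (FermatReal.ext f hf) (Set.Icc a b) p) ∧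
    (∃ q ∈ Set.Icc a b, IsMinOn (FermatReal.ext f hf) (Set.Icc a b) q) ∧
    ((∀ u : ℝ, ¬ IsFlatPoint f u) →
      ∃ c d : FermatReal, c ≤ d ∧
        FermatReal.ext f hf '' Set.Icc a b = Set.Icc c d ∧
        (a.st < b.st ∨ deriv f a.st ≠ 0 → c < d)) := by
  obtain ⟨p, hp, hmax⟩ := FermatReal.exists_isMaxOn hf hab.le
  obtain ⟨q, hq, hmin⟩ := FermatReal.exists_isMinOn hf hab.le
  rw [isMaxOn_iff] at hmax
  rw [isMinOn_iff] at hmin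
  refine ⟨⟨p, hp, hmax⟩, ⟨q, hq, hmin⟩, fun hflat => ?_⟩
  -- The endpoints of the image are the values at the minimiser `q` and the maximiser `p`.
  refine ⟨_, _, hmin p hp, Subset.antisymm ?_ fun y hy => ?_, fun h => ?_⟩
  · rintro _ ⟨x, hx, rfl⟩
    exact ⟨hmin x hx, hmax x hx⟩
  · rcases le_total p q with h | h
    · obtain ⟨x, hx, hxy⟩ := FermatReal.hasIVT (hf := hf) hflat h y (Icc_subset_uIcc' hy)
      exact ⟨x, ⟨hp.1.trans hx.1, hx.2.trans hq.2⟩, hxy⟩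
    · obtain ⟨x, hx, hxy⟩ := FermatReal.hasIVT (hf := hf) hflat h y (Icc_subset_uIcc hy)
      exact ⟨x, ⟨hq.1.trans hx.1, hx.2.trans hp.2⟩, hxy⟩
  · obtain ⟨x, hx, hne⟩ := FermatReal.exists_ext_ne (hf := hf) hflat hab h (FermatReal.ext f hf q)
    exact (lt_of_le_of_ne (hmin x hx) hne.symm).trans_le (hmax x hx)
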